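/- Setting. At iteration $t$ of a learning algorithm let $p_t(\cdot\mid w,B)$ be the probability law of the outcome given the previous outcome $w$ and a finite dataset (multiset) $B$. Let $\lambda>0$, and let $\mathcal D_{\alpha}(P\|Q)=\frac1{\alpha-1}\log\int (dP/dQ)^{\alpha}\,dQ$ ($=\infty$ if $P\not\ll Q$) be the Rényi divergence of order $\alpha>1$. For a dataset $D$ and a data distribution $\mu$, the privacy cost is $$c_t(\lambda)=\max\Big\{\log\mathbb E_{x\sim\mu}\,e^{\lambda\mathcal D_{\lambda+1}(p_t(\cdot\mid w,D)\,\|\,p_t(\cdot\mid w,D\cup\{x\}))},\ \log\mathbb E_{x\sim\mu}\,e^{\lambda\mathcal D_{\lambda+1}(p_t(\cdot\mid w,D\cup\{x\})\,\|\,p_t(\cdot\mid w,D))}\Big\}.$$ Estimator. Let $m\ge 2$, let $B$ be a batch with points $x_1,\dots,x_m\in B$, put $\hat p=p_t(\cdot\mid w,B)$, $\hat q_i=p_t(\cdot\mid w,B\setminus\{x_i\})$, and assume that $y_i=\exp\big(\lambda\max\{\mathcal D_{\lambda+1}(\hat p\|\hat q_i),\mathcal D_{\lambda+1}(\hat q_i\|\hat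 p)\}\big)$ is finite for all $i$. Let $M=\frac1m\sum_i y_i$, $S=\sqrt{\frac1m\sum_i y_i^2-M^2}$, and assume $S>0$. For $0<\gamma<1$ let $$\hat c_t(\lambda)=\log\Big[M+\frac{F^{-1}(1-\gamma,m-1)}{\sqrt{m-1}}\,S\Big],$$ where $F^{-1}(\cdot,m-1)$ is the inverse of the distribution function of Student's $t$-distribution with $m-1$ degrees of freedom, and $\log r=-\infty$ for $r\le 0$. Bayesian model. Given the unknown mean $\rho$ and standard deviation $\sigma>0$, the observations $(y_1,\dots,y_m)$ are modelled by the (continuous) density on $\mathbb R^m$ that maximises differential entropy among all densities of finite entropy whose coordinates all have mean $\rho$ and variance $\sigma^2$. The prior is the uninformative one, flat in $(\rho,\log\sigma)$. Write $\Pr$ for the posterior distribution of $(\rho,\sigma)$ given the observed values $y_1,\dots,y_m$. Theorem. The posterior is a proper probability distribution; under it, $\frac{M-\rho}{S}\sqrt{m-1}$ has Student's $t$-distribution with $m-1$ degrees of freedom; and the estimator overestimates the privacy cost with probability at least $1-\gamma$: $$\Pr\big[\hat c_t(\lambda)<\log\rho\big]\le\gamma .$$ Consequently, for every dataset $D$,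 the posterior (outer) probability of the set of those $(\rho,\sigma)$ for which some data distribution $\mu$ with $\mathbb E_{x\sim\mu}\,e^{\lambda\max\{\mathcal D_{\lambda+1}(p_t(\cdot\mid w,D)\|p_t(\cdot\mid w,D\cup\{x\})),\,\mathcal D_{\lambda+1}(p_t(\cdot\mid w,D\cup\{x\})\|p_t(\cdot\mid w,D))\}}=\rho$ has privacy cost $c_t(\lambda)>\hat c_t(\lambda)$ is at most $\gamma$. -/

import Mathlib

open MeasureTheory Set
open scoped ENNReal

noncomputable section

namespace BayesDP

/-! ### Rényi divergence and the privacy cost -/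

/-- Rényi divergence of order `α > 1`: `(α - 1)⁻¹ log ∫ q (p / q) ^ α`, equal to `∞` when `P` is
not absolutely continuous with respect to `Q`. -/
def renyiDiv {W : Type*} [MeasurableSpace W] (α : ℝ) (P Q : Measure W) : EReal :=
  open Classical in
  if P ≪ Q then (((α - 1)⁻¹ : ℝ) : EReal) * ENNReal.log (∫⁻ w, (P.rnDeriv Q w) ^ α ∂Q) else ⊤

/-- The two-sided divergence `max {D_{lam+1}(P ‖ Q), D_{lam+1}(Q ‖ P)}`. -/
def maxRenyi {W : Type*} [MeasurableSpace W] (lam : ℝ) (P Q : Measure W) : EReal :=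
  max (renyiDiv (lam + 1) P Q) (renyiDiv (lam + 1) Q P)

/-- The privacy cost at a dataset `D`, for a data distribution `μ`: the logarithm of
`E_x exp (lam * D_{lam+1}(p_t ‖ q_t))`, where `p_t`, `q_t` are the outcome laws on the adjacent
datasets `D` and `D ∪ {x}`, `x ∼ μ`, and the larger of the two orders of the pair is taken.
Here `p D` is the law of the outcome of the current iteration on the dataset `D`. -/
def privacyCost {X W : Type*} [MeasurableSpace X] [MeasurableSpace W]
    (p : Multiset X → Measure W) (lam : ℝ) (D : Multiset X) (μ : Measure X) : EReal :=
  max (ENNReal.log (∫⁻ x, EReal.exp ((lam : EReal) * renyiDiv (lam + 1) (p D) (p (x ::ₘ D))) ∂μ))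
    (ENNReal.log (∫⁻ x, EReal.exp ((lam : EReal) * renyiDiv (lam + 1) (p (x ::ₘ D)) (p D)) ∂μ))

/-- `E_x exp (lam * max {D_{lam+1}(p_t ‖ q_t), D_{lam+1}(q_t ‖ p_t)})`, the expectation of which
the sample values below are observations. -/
def expectedExpDiv {X W : Type*} [MeasurableSpace X] [MeasurableSpace W]
    (p : Multiset X → Measure W) (lam : ℝ) (D : Multiset X) (μ : Measure X) : ℝ≥0∞ :=
  ∫⁻ x, EReal.exp ((lam : EReal) * maxRenyi lam (p D) (p (x ::ₘ D))) ∂μ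

/-- The `i`-th sample value `exp (lam * max {D_{lam+1}(p̂ ‖ q̂), D_{lam+1}(q̂ ‖ p̂)})`, where `p̂`
is the outcome law on the batch `B` and `q̂` the one on `B` without `x i`. -/
def sampleValue {X W : Type*} [DecidableEq X] [MeasurableSpace W]
    (p : Multiset X → Measure W) (lam : ℝ) (B : Multiset X) {m : ℕ} (x : Fin m → X) :
    Fin m → ℝ :=
  fun i => (EReal.exp ((lam : EReal) * maxRenyi lam (p B) (p (B.erase (x i))))).toReal

/-! ### Student's t-distribution -/

/-- Density of Student's t-distribution with `ν` degrees of freedom. -/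
def studentPDF (ν z : ℝ) : ℝ :=
  Real.Gamma ((ν + 1) / 2) / (Real.sqrt (ν * Real.pi) * Real.Gamma (ν / 2)) *
    (1 + z ^ 2 / ν) ^ (-((ν + 1) / 2))

/-- Student's t-distribution with `ν` degrees of freedom. -/
def studentT (ν : ℝ) : Measure ℝ :=
  volume.withDensity fun z => ENNReal.ofReal (studentPDF ν z)

/-- The inverse of the distribution function of Student's t-distribution. -/
def studentQuantile (ν u : ℝ) : ℝ :=
  sInf {z : ℝ | u ≤ ∫ s in Iic z, studentPDF ν s}

/-! ### The estimator -/

/-- The sample mean `M`. -/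
def sampleMean {m : ℕ} (y : Fin m → ℝ) : ℝ := (∑ i, y i) / m

/-- The sample deviation `S`, normalised by `m`. -/
def sampleDev {m : ℕ} (y : Fin m → ℝ) : ℝ :=
  Real.sqrt ((∑ i, y i ^ 2) / m - sampleMean y ^ 2)

/-- The logarithm, with value `-∞` at the non-positive numbers. -/
def extLog (r : ℝ) : EReal := ENNReal.log (ENNReal.ofReal r)

/-- The estimator `log [M + F⁻¹(1 - γ, m - 1) / √(m - 1) * S]`. -/
def costEstimator {m : ℕ} (γ : ℝ) (y : Fin m → ℝ) : EReal :=
  extLog (sampleMean y +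
    studentQuantile ((m : ℝ) - 1) (1 - γ) / Real.sqrt ((m : ℝ) - 1) * sampleDev y)

/-! ### The maximum-entropy model and the posterior under the flat prior -/

/-- Differential entropy `-∫ f log f` of a density on `ℝ^m`. -/
def diffEntropy {m : ℕ} (f : (Fin m → ℝ) → ℝ) : ℝ := ∫ z, Real.negMulLog (f z)

/-- `f` is a probability density on `ℝ^m` with finite differential entropy, all of whose
coordinates have the common mean `ρ` and the common variance `σ ^ 2`. -/
structure HasCommonMoments {m : ℕ} (ρ σ : ℝ) (f : (Fin m → ℝ) → ℝ) : Prop where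
  nonneg : ∀ z, 0 ≤ f z
  integrable : Integrable f
  integral_eq_one : ∫ z, f z = 1
  integrable_mean : ∀ i, Integrable fun z => z i * f z
  mean_eq : ∀ i, ∫ z, z i * f z = ρ
  integrable_var : ∀ i, Integrable fun z => (z i - ρ) ^ 2 * f z
  var_eq : ∀ i, ∫ z, (z i - ρ) ^ 2 * f z = σ ^ 2
  integrable_entropy : Integrable fun z => Real.negMulLog (f z)

/-- `f` is a maximum-entropy density for `m` observations with common mean `ρ` and common
variance `σ ^ 2`. (A competitor with entropy `-∞` cannot violate the last condition, so only those
of finite entropy are listed.) -/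
structure IsMaxEntropyDensity {m : ℕ} (ρ σ : ℝ) (f : (Fin m → ℝ) → ℝ) : Prop where
  admissible : HasCommonMoments ρ σ f
  entropy_le : ∀ g : (Fin m → ℝ) → ℝ, HasCommonMoments ρ σ g → diffEntropy g ≤ diffEntropy f

/-- `f ρ σ` is, for each mean `ρ` and standard deviation `σ > 0`, the (continuous version of the)
maximum-entropy density of the `m` observations. -/
def IsMaxEntropyModel {m : ℕ} (f : ℝ → ℝ → (Fin m → ℝ) → ℝ) : Prop :=
  ∀ ρ σ : ℝ, 0 < σ → Continuous (f ρ σ) ∧ IsMaxEntropyDensity ρ σ (f ρ σ)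

/-- The (improper) uninformative prior, flat in the location `ρ` and in the logarithm of the
scale `σ`: a parameter is a pair `θ = (ρ, log σ)`. -/
def flatPrior : Measure (ℝ × ℝ) := volume

/-- Prior times likelihood at the observations `y`. -/
def jointWeight {m : ℕ} (f : ℝ → ℝ → (Fin m → ℝ) → ℝ) (y : Fin m → ℝ) : Measure (ℝ × ℝ) :=
  flatPrior.withDensity fun θ => ENNReal.ofReal (f θ.1 (Real.exp θ.2) y)

/-- The posterior distribution of `(ρ, log σ)` given the observations `y` (Bayes' rule). -/
def posterior {m : ℕ} (f : ℝ → ℝ → (Fin m → ℝ) → ℝ) (y : Fin m → ℝ) : Measure (ℝ × ℝ) :=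
  (jointWeight f y univ)⁻¹ • jointWeight f y

end BayesDP

end

/-!
Let `g` be the density of independent Gaussian variables with given moments. The integral of
`f log g` is the same for all densities `f` with these moments, so an `f` of maximal entropy gives
equality in Gibbs' inequality and is `g`.

Under the flat prior on `(ρ, τ) = (ρ, log σ)` the precision `u = exp (-2 * τ)` then has a Gamma law
given `ρ`, and integrating it out leaves for `ρ` a multiple of Student's density at
`(M - ρ) / S * √(m - 1)`. The estimator falls below `log ρ` only if this statistic is below minus
the `(1 - γ)`-quantile, which has probability at most `γ` by symmetry. Finally the maximum of two
expectations in the privacy cost is at most the expectation of the maximum, which is `ρ`.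
-/

noncomputable section

open ProbabilityTheory
open scoped NNReal

namespace BayesDP

/-! ### Gibbs' inequality -/

lemma mul_klFun_div (a : ℝ) {b : ℝ} (hb : b ≠ 0) :
    b * InformationTheory.klFun (a / b) = a * Real.log a - a * Real.log b + (b - a) := by
  rcases eq_or_ne a 0 with rfl | ha
  · simp [InformationTheory.klFun_zero]
  · rw [InformationTheory.klFun_apply, Real.log_div ha hb]
    field_simp
    ring

lemma ae_eq_of_integral_mul_log_le {α : Type*} [MeasurableSpace α] {μ : Measure α} {f g : α → ℝ}
    (hf : ∀ᵐ z ∂μ, 0 ≤ f z) (hg : ∀ᵐ z ∂μ, 0 < g z) (hf_int : Integrable f μ)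
    (hg_int : Integrable g μ) (hff : Integrable (fun z => f z * Real.log (f z)) μ)
    (hfg : Integrable (fun z => f z * Real.log (g z)) μ) (hmass : ∫ z, g z ∂μ ≤ ∫ z, f z ∂μ)
    (hle : ∫ z, f z * Real.log (f z) ∂μ ≤ ∫ z, f z * Real.log (g z) ∂μ) :
    f =ᵐ[μ] g := by
  let k : α → ℝ := fun z => f z * Real.log (f z) - f z * Real.log (g z) + (g z - f z)
  have hlog : Integrable (fun z => f z * Real.log (f z) - f z * Real.log (g z)) μ := hff.sub hfg
  have hsub : Integrable (fun z => g z - f z) μ := hg_int.sub hf_int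
  have hk_int : Integrable k μ := hlog.add hsub
  have hk_eq : ∀ᵐ z ∂μ, k z = g z * InformationTheory.klFun (f z / g z) := by
    filter_upwards [hg] with z hz using (mul_klFun_div (f z) hz.ne').symm
  have hk_nonneg : 0 ≤ᵐ[μ] k := by
    filter_upwards [hf, hg, hk_eq] with z hfz hgz hkz
    rw [hkz]
    exact mul_nonneg hgz.le (InformationTheory.klFun_nonneg (div_nonneg hfz hgz.le))
  have hk_integral : ∫ z, k z ∂μ ≤ 0 := by
    rw [integral_add hlog hsub, integral_sub hff hfg, integral_sub hg_int hf_int]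
    linarith
  have hk_zero : k =ᵐ[μ] 0 := (integral_eq_zero_iff_of_nonneg_ae hk_nonneg hk_int).mp
    (hk_integral.antisymm (integral_nonneg_of_ae hk_nonneg))
  filter_upwards [hf, hg, hk_eq, hk_zero] with z hfz hgz hkz hz
  rw [hkz, Pi.zero_apply, mul_eq_zero_iff_left hgz.ne',
    InformationTheory.klFun_eq_zero_iff (div_nonneg hfz hgz.le)] at hz
  exact (div_eq_one_iff_eq hgz.ne').mp hz

/-! ### Products of Gaussian densities -/

section GaussianProduct

variable {ι : Type*} [Fintype ι]

/-- The joint density of independent Gaussian variables, indexed by `ι`, of common mean `ρ` and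
common variance `v`. -/
def gaussianProdPDF (ρ : ℝ) (v : ℝ≥0) (z : ι → ℝ) : ℝ :=
  ∏ i, gaussianPDFReal ρ v (z i)

lemma gaussianProdPDF_pos (ρ : ℝ) {v : ℝ≥0} (hv : v ≠ 0) (z : ι → ℝ) :
    0 < gaussianProdPDF ρ v z :=
  Finset.prod_pos fun _ _ => gaussianPDFReal_pos _ _ _ hv

@[fun_prop]
lemma continuous_gaussianProdPDF (ρ : ℝ) (v : ℝ≥0) :
    Continuous (gaussianProdPDF ρ v : (ι → ℝ) → ℝ) := by
  unfold gaussianProdPDF gaussianPDFReal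
  fun_prop

lemma gaussianProdPDF_eq (ρ : ℝ) (v : ℝ≥0) (z : ι → ℝ) :
    gaussianProdPDF ρ v z = (√(2 * Real.pi * v))⁻¹ ^ Fintype.card ι *
      Real.exp (-(2 * v : ℝ)⁻¹ * ∑ i, (z i - ρ) ^ 2) := by
  simp_rw [gaussianProdPDF, gaussianPDFReal, Finset.prod_mul_distrib, ← Real.exp_sum]
  simp only [Finset.prod_const, Finset.card_univ, Finset.mul_sum]
  congr! 3
  ring

lemma log_gaussianProdPDF (ρ : ℝ) {v : ℝ≥0} (hv : v ≠ 0) (z : ι → ℝ) :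
    Real.log (gaussianProdPDF ρ v z) =
      -(Fintype.card ι * Real.log √(2 * Real.pi * v)) -
        (2 * v : ℝ)⁻¹ * ∑ i, (z i - ρ) ^ 2 := by
  have : (0 : ℝ) < v := by positivity
  rw [gaussianProdPDF_eq, Real.log_mul (by positivity) (by positivity), Real.log_pow,
    Real.log_inv, Real.log_exp]
  ring

lemma integrable_gaussianProdPDF (ρ : ℝ) (v : ℝ≥0) :
    Integrable (gaussianProdPDF ρ v : (ι → ℝ) → ℝ) :=
  Integrable.fintype_prod fun _ => integrable_gaussianPDFReal ρ v

lemma integral_gaussianProdPDF (ρ : ℝ) {v : ℝ≥0} (hv : v ≠ 0) :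
    ∫ z : ι → ℝ, gaussianProdPDF ρ v z = 1 := by
  simp_rw [gaussianProdPDF]
  rw [integral_fintype_prod_volume_eq_prod]
  exact Finset.prod_eq_one fun _ _ => integral_gaussianPDFReal_eq_one ρ hv

lemma apply_mul_gaussianProdPDF [DecidableEq ι] (ρ : ℝ) (v : ℝ≥0) (h : ℝ → ℝ) (i : ι)
    (z : ι → ℝ) :
    h (z i) * gaussianProdPDF ρ v z =
      ∏ j, Function.update (fun _ => gaussianPDFReal ρ v) i
        (fun t => h t * gaussianPDFReal ρ v t) j (z j) := by
  rw [gaussianProdPDF, ← Finset.mul_prod_erase _ _ (Finset.mem_univ i),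
    ← Finset.mul_prod_erase _ _ (Finset.mem_univ i), Function.update_self, mul_assoc]
  congr! 3 with j hj
  rw [Function.update_of_ne (Finset.ne_of_mem_erase hj)]

lemma integrable_mul_gaussianPDFReal_iff {ρ : ℝ} {v : ℝ≥0} (hv : v ≠ 0) {h : ℝ → ℝ} :
    Integrable (fun t => h t * gaussianPDFReal ρ v t) ↔ Integrable h (gaussianReal ρ v) := by
  rw [gaussianReal_of_var_ne_zero _ hv, integrable_withDensity_iff (measurable_gaussianPDF _ _)
    (ae_of_all _ fun _ => gaussianPDF_lt_top)]
  simp only [toReal_gaussianPDF]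

lemma integrable_apply_mul_gaussianProdPDF {ρ : ℝ} {v : ℝ≥0} (hv : v ≠ 0) {h : ℝ → ℝ}
    (hh : Integrable h (gaussianReal ρ v)) (i : ι) :
    Integrable fun z : ι → ℝ => h (z i) * gaussianProdPDF ρ v z := by
  classical
  simp_rw [apply_mul_gaussianProdPDF ρ v h i]
  refine Integrable.fintype_prod fun j => ?_
  rcases eq_or_ne j i with rfl | hj
  · rw [Function.update_self]
    exact (integrable_mul_gaussianPDFReal_iff hv).mpr hh
  · rw [Function.update_of_ne hj]
    exact integrable_gaussianPDFReal ρ v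

lemma integral_apply_mul_gaussianProdPDF (ρ : ℝ) {v : ℝ≥0} (hv : v ≠ 0) (h : ℝ → ℝ) (i : ι) :
    ∫ z : ι → ℝ, h (z i) * gaussianProdPDF ρ v z = ∫ t, h t ∂gaussianReal ρ v := by
  classical
  simp_rw [apply_mul_gaussianProdPDF ρ v h i]
  rw [integral_fintype_prod_volume_eq_prod, ← Finset.mul_prod_erase _ _ (Finset.mem_univ i),
    Finset.prod_eq_one, mul_one, Function.update_self, integral_gaussianReal_eq_integral_smul hv]
  · simp only [smul_eq_mul, mul_comm]
  · intro j hj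
    rw [Function.update_of_ne (Finset.ne_of_mem_erase hj), integral_gaussianPDFReal_eq_one ρ hv]

end GaussianProduct

/-! ### The maximum-entropy density -/

section MaxEntropy

variable {m : ℕ} {ρ σ : ℝ} {v : ℝ≥0} {f : (Fin m → ℝ) → ℝ}

lemma mul_log_gaussianProdPDF (hv : v ≠ 0) (f : (Fin m → ℝ) → ℝ) (z : Fin m → ℝ) :
    f z * Real.log (gaussianProdPDF ρ v z) =
      -(m * Real.log √(2 * Real.pi * v)) * f z
        - (2 * v : ℝ)⁻¹ * ∑ i, (z i - ρ) ^ 2 * f z := by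
  rw [log_gaussianProdPDF ρ hv, ← Finset.sum_mul, Fintype.card_fin]
  ring

lemma HasCommonMoments.integrable_mul_log_gaussianProdPDF (hf : HasCommonMoments ρ σ f)
    (hv : v ≠ 0) : Integrable fun z => f z * Real.log (gaussianProdPDF ρ v z) := by
  simp_rw [mul_log_gaussianProdPDF hv f]
  exact (hf.integrable.const_mul _).sub
    ((integrable_finsetSum _ fun i _ => hf.integrable_var i).const_mul _)

lemma HasCommonMoments.integral_mul_log_gaussianProdPDF (hf : HasCommonMoments ρ σ f)
    (hv : v ≠ 0) :
    ∫ z, f z * Real.log (gaussianProdPDF ρ v z) =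
      -(m * Real.log √(2 * Real.pi * v)) - (2 * v : ℝ)⁻¹ * (m * σ ^ 2) := by
  have hvar := integrable_finsetSum Finset.univ fun i _ => hf.integrable_var i
  simp_rw [mul_log_gaussianProdPDF hv f]
  rw [integral_sub (hf.integrable.const_mul _) (hvar.const_mul _), integral_const_mul,
    integral_const_mul, hf.integral_eq_one, integral_finsetSum _ fun i _ => hf.integrable_var i]
  simp [hf.var_eq]

lemma hasCommonMoments_gaussianProdPDF (ρ : ℝ) (hv : v ≠ 0) :
    HasCommonMoments ρ √v (gaussianProdPDF ρ v : (Fin m → ℝ) → ℝ) := by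
  have h_id : Integrable (fun t : ℝ => t) (gaussianReal ρ v) :=
    (memLp_id_gaussianReal 1).integrable le_rfl
  have h_sq : Integrable (fun t : ℝ => (t - ρ) ^ 2) (gaussianReal ρ v) :=
    ((memLp_id_gaussianReal 2).sub (memLp_const ρ)).integrable_sq
  have h_var : ∫ t, (t - ρ) ^ 2 ∂gaussianReal ρ v = v := by
    rw [← variance_fun_id_gaussianReal (μ := ρ), variance_eq_integral (by fun_prop),
      integral_id_gaussianReal]
  have h_var_int := fun i : Fin m => integrable_apply_mul_gaussianProdPDF hv h_sq i
  refine ⟨fun z => (gaussianProdPDF_pos ρ hv z).le, integrable_gaussianProdPDF ρ v,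
    integral_gaussianProdPDF ρ hv, integrable_apply_mul_gaussianProdPDF hv h_id, fun i => ?_,
    h_var_int, fun i => ?_, ?_⟩
  · rw [integral_apply_mul_gaussianProdPDF ρ hv fun t => t, integral_id_gaussianReal]
  · rw [integral_apply_mul_gaussianProdPDF ρ hv fun t => (t - ρ) ^ 2, h_var,
      Real.sq_sqrt v.coe_nonneg]
  · simp_rw [Real.negMulLog, neg_mul, mul_log_gaussianProdPDF hv]
    exact (((integrable_gaussianProdPDF ρ v).const_mul _).sub
      ((integrable_finsetSum _ fun i _ => h_var_int i).const_mul _)).neg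

/-- The cross-entropy with the Gaussian density depends only on the moments, so that for `f` it is
the entropy of the Gaussian, which is at most the entropy of `f`: equality in Gibbs' inequality. -/
lemma IsMaxEntropyDensity.ae_eq_gaussianProdPDF (hf : IsMaxEntropyDensity ρ √v f) (hv : v ≠ 0) :
    f =ᵐ[volume] gaussianProdPDF ρ v := by
  have hg : HasCommonMoments ρ √v (gaussianProdPDF ρ v : (Fin m → ℝ) → ℝ) :=
    hasCommonMoments_gaussianProdPDF ρ hv
  have hcross : ∫ z, f z * Real.log (gaussianProdPDF ρ v z) =
      ∫ z : Fin m → ℝ, gaussianProdPDF ρ v z * Real.log (gaussianProdPDF ρ v z) := by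
    rw [hf.admissible.integral_mul_log_gaussianProdPDF hv, hg.integral_mul_log_gaussianProdPDF hv]
  have hff : Integrable fun z => f z * Real.log (f z) := by
    simpa [Real.negMulLog] using hf.admissible.integrable_entropy.neg
  refine ae_eq_of_integral_mul_log_le (ae_of_all _ hf.admissible.nonneg)
    (ae_of_all _ (gaussianProdPDF_pos ρ hv)) hf.admissible.integrable hg.integrable hff
    (hf.admissible.integrable_mul_log_gaussianProdPDF hv) ?_ ?_
  · rw [hf.admissible.integral_eq_one, hg.integral_eq_one]
  · have hle := hf.entropy_le _ hg
    simp only [diffEntropy, Real.negMulLog, neg_mul, integral_neg, neg_le_neg_iff] at hle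
    rwa [hcross]

lemma IsMaxEntropyModel.eq_gaussianProdPDF {f : ℝ → ℝ → (Fin m → ℝ) → ℝ}
    (hf : IsMaxEntropyModel f) (ρ : ℝ) (hv : v ≠ 0) :
    f ρ √v = gaussianProdPDF ρ v := by
  obtain ⟨hcont, hmax⟩ := hf ρ √v (Real.sqrt_pos.mpr (by positivity))
  exact (hcont.ae_eq_iff_eq volume (continuous_gaussianProdPDF ρ v)).mp
    (hmax.ae_eq_gaussianProdPDF hv)

end MaxEntropy

/-! ### Image measures -/

section ImageMeasures

variable {α β : Type*} [MeasurableSpace α] [MeasurableSpace β]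

lemma map_withDensity_comp {μ : Measure α} {T : α → β} {g : β → ℝ≥0∞} (hT : Measurable T)
    (hg : Measurable g) :
    (μ.withDensity fun x => g (T x)).map T = (μ.map T).withDensity g := by
  ext s hs
  rw [Measure.map_apply hT hs, withDensity_apply _ (hT hs), withDensity_apply _ hs,
    setLIntegral_map hs hg hT]

lemma map_fst_withDensity_prod (μ : Measure α) (ν : Measure β) [SFinite μ] [SFinite ν]
    {g : α × β → ℝ≥0∞} (hg : Measurable g) :
    ((μ.prod ν).withDensity g).map Prod.fst = μ.withDensity fun x => ∫⁻ y, g (x, y) ∂ν := by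
  ext s hs
  rw [Measure.map_apply measurable_fst hs, withDensity_apply _ (measurable_fst hs),
    withDensity_apply _ hs, ← prod_univ, setLIntegral_prod _ hg.aemeasurable]
  simp_rw [setLIntegral_univ]

lemma measure_univ_eq_of_map_eq_smul {μ : Measure α} {ν : Measure β} [IsProbabilityMeasure ν]
    {T : α → β} (hT : Measurable T) {c : ℝ≥0∞} (h : μ.map T = c • ν) : μ univ = c := by
  rw [← preimage_univ (f := T), ← Measure.map_apply hT .univ, h, Measure.smul_apply, measure_univ,
    smul_eq_mul, mul_one]

lemma map_sub_left_mul_volume (M : ℝ) {k : ℝ} (hk : k ≠ 0) :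
    (volume : Measure ℝ).map (fun ρ => (M - ρ) * k) = ENNReal.ofReal |k⁻¹| • volume := by
  calc (volume : Measure ℝ).map (fun ρ => (M - ρ) * k)
      = ((volume : Measure ℝ).map (fun ρ => M - ρ)).map (· * k) :=
        (Measure.map_map (measurable_mul_const k) (measurable_const_sub M)).symm
    _ = ENNReal.ofReal |k⁻¹| • volume := by
        rw [Measure.map_sub_left_eq_self, Real.map_volume_mul_right hk]

lemma lintegral_comp_exp_mul {c : ℝ} (hc : c ≠ 0) (h : ℝ → ℝ≥0∞) :
    ∫⁻ τ, ENNReal.ofReal (|c| * Real.exp (c * τ)) * h (Real.exp (c * τ)) =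
      ∫⁻ u in Ioi 0, h u := by
  have hrange : (fun τ => Real.exp (c * τ)) '' univ = Ioi 0 := by
    rw [image_univ, ← Real.range_exp]
    exact (mul_left_surjective₀ hc).range_comp Real.exp
  have hderiv (τ : ℝ) (_ : τ ∈ univ) :
      HasDerivWithinAt (fun τ => Real.exp (c * τ)) (Real.exp (c * τ) * c) univ τ := by
    simpa using (((hasDerivAt_id τ).const_mul c).exp).hasDerivWithinAt (s := univ)
  have hinj : InjOn (fun τ => Real.exp (c * τ)) univ :=
    (Real.exp_injective.comp (mul_right_injective₀ hc)).injOn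
  rw [← hrange, lintegral_image_eq_lintegral_abs_deriv_mul .univ hderiv hinj, setLIntegral_univ]
  simp only [abs_mul, Real.abs_exp, mul_comm |c|]

end ImageMeasures

/-! ### Student's law as a Gaussian mixture -/

lemma setLIntegral_Ioi_gammaPDF {a r : ℝ} (ha : 0 < a) (hr : 0 < r) :
    ∫⁻ u in Ioi 0, gammaPDF a r u = 1 := by
  have hIic : ∫⁻ u in Iic 0, gammaPDF a r u = 0 := by
    rw [← setLIntegral_congr Iio_ae_eq_Iic, lintegral_gammaPDF_of_nonpos le_rfl]
  have hsplit := lintegral_add_compl (μ := volume) (gammaPDF a r) (measurableSet_Ioi (a := 0))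
  rwa [compl_Ioi, hIic, add_zero, lintegral_gammaPDF_eq_one ha hr] at hsplit

lemma measurable_studentPDF (ν : ℝ) : Measurable (studentPDF ν) := by
  unfold studentPDF
  fun_prop

lemma studentPDF_nonneg {ν : ℝ} (hν : 0 < ν) (z : ℝ) : 0 ≤ studentPDF ν z := by
  unfold studentPDF
  positivity

lemma studentPDF_neg (ν z : ℝ) : studentPDF ν (-z) = studentPDF ν z := by
  simp only [studentPDF, neg_sq]

/-- Conjugacy: if `u` has a Gamma law and `z` is Gaussian of variance `u⁻¹` given `u`, then `z` has
Student's law, and `u` has again a Gamma law given `z`. -/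
lemma gammaPDFReal_mul_gaussianPDFReal {ν u : ℝ} (hν : 0 < ν) (hu : 0 < u) (z : ℝ) :
    gammaPDFReal (ν / 2) (ν / 2) u * gaussianPDFReal 0 u⁻¹.toNNReal z =
      studentPDF ν z * gammaPDFReal ((ν + 1) / 2) ((ν + z ^ 2) / 2) u := by
  have hpow : u ^ ((ν + 1) / 2 - 1) = u ^ (ν / 2 - 1) * √u := by
    rw [Real.sqrt_eq_rpow, ← Real.rpow_add hu]
    ring_nf
  have hexp : Real.exp (-((ν + z ^ 2) / 2 * u)) =
      Real.exp (-(ν / 2 * u)) * Real.exp (-z ^ 2 / (2 * u⁻¹)) := by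
    rw [← Real.exp_add]
    congr 1
    field_simp
    ring
  have hrate : (1 + z ^ 2 / ν) ^ (-((ν + 1) / 2)) * ((ν + z ^ 2) / 2) ^ ((ν + 1) / 2) =
      (ν / 2) ^ (ν / 2) * √(ν / 2) := by
    have hfactor : (ν + z ^ 2) / 2 = ν / 2 * (1 + z ^ 2 / ν) := by field_simp
    rw [hfactor, Real.mul_rpow (by positivity) (by positivity), Real.rpow_neg (by positivity),
      mul_left_comm, inv_mul_cancel₀ (by positivity), mul_one, Real.sqrt_eq_rpow,
      ← Real.rpow_add (by positivity)]
    ring_nf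
  have hsqrt : √(ν * Real.pi) = √(ν / 2) * √(2 * Real.pi) := by
    rw [← Real.sqrt_mul (by positivity)]
    congr 1
    ring
  rw [gammaPDFReal, gammaPDFReal, if_pos hu.le, if_pos hu.le, gaussianPDFReal, studentPDF,
    Real.coe_toNNReal _ (inv_pos.mpr hu).le, sub_zero, Real.sqrt_mul (by positivity),
    Real.sqrt_inv, hpow, hexp, hsqrt]
  generalize (1 + z ^ 2 / ν) ^ (-((ν + 1) / 2)) = A at hrate ⊢
  field_simp
  linear_combination -hrate

lemma lintegral_studentPDF {ν : ℝ} (hν : 0 < ν) :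
    ∫⁻ z, ENNReal.ofReal (studentPDF ν z) = 1 := by
  have hgamma : Measurable (gammaPDF (ν / 2) (ν / 2)) :=
    (measurable_gammaPDFReal _ _).ennreal_ofReal
  have hmixture (z : ℝ) : ENNReal.ofReal (studentPDF ν z) = ∫⁻ u in Ioi 0,
      gammaPDF (ν / 2) (ν / 2) u * gaussianPDF 0 (u⁻¹.toNNReal) z := by
    rw [← mul_one (ENNReal.ofReal _), ← setLIntegral_Ioi_gammaPDF
      (by positivity : 0 < (ν + 1) / 2) (by positivity : 0 < (ν + z ^ 2) / 2),
      ← lintegral_const_mul' _ _ ENNReal.ofReal_ne_top]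
    refine setLIntegral_congr_fun measurableSet_Ioi fun u (hu : 0 < u) => ?_
    simp only [gammaPDF, gaussianPDF]
    rw [← ENNReal.ofReal_mul (studentPDF_nonneg hν z), ← gammaPDFReal_mul_gaussianPDFReal hν hu,
      ENNReal.ofReal_mul (gammaPDFReal_nonneg (by positivity) (by positivity) u)]
  calc ∫⁻ z, ENNReal.ofReal (studentPDF ν z)
      = ∫⁻ u in Ioi 0, ∫⁻ z,
          gammaPDF (ν / 2) (ν / 2) u * gaussianPDF 0 (u⁻¹.toNNReal) z := by
        simp_rw [hmixture]
        exact lintegral_lintegral_swap (by fun_prop)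
    _ = ∫⁻ u in Ioi 0, gammaPDF (ν / 2) (ν / 2) u := by
        refine setLIntegral_congr_fun measurableSet_Ioi fun u (hu : 0 < u) => ?_
        have hvar : u⁻¹.toNNReal ≠ 0 := by simpa using hu
        simp only [lintegral_const_mul _ (measurable_gaussianPDF _ _),
          lintegral_gaussianPDF_eq_one 0 hvar, mul_one]
    _ = 1 := setLIntegral_Ioi_gammaPDF (half_pos hν) (half_pos hν)

lemma isProbabilityMeasure_studentT {ν : ℝ} (hν : 0 < ν) : IsProbabilityMeasure (studentT ν) :=
  ⟨by rw [studentT, withDensity_apply _ .univ, setLIntegral_univ, lintegral_studentPDF hν]⟩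

lemma map_neg_studentT (ν : ℝ) : (studentT ν).map Neg.neg = studentT ν := by
  have hmap := map_withDensity_comp (μ := volume) measurable_neg
    (measurable_studentPDF ν).ennreal_ofReal
  simp only [studentPDF_neg] at hmap
  rw [studentT, hmap, Measure.map_neg_eq_self]

lemma setIntegral_Iic_studentPDF {ν : ℝ} (hν : 0 < ν) (z : ℝ) :
    ∫ s in Iic z, studentPDF ν s = cdf (studentT ν) z := by
  have := isProbabilityMeasure_studentT hν
  rw [cdf_eq_real, Measure.real, studentT, withDensity_apply _ measurableSet_Iic,
    integral_eq_lintegral_of_nonneg_ae (ae_of_all _ (studentPDF_nonneg hν))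
      (measurable_studentPDF ν).aestronglyMeasurable]

lemma studentQuantile_eq_sInf_cdf {ν : ℝ} (hν : 0 < ν) (u : ℝ) :
    studentQuantile ν u = sInf {z | u ≤ cdf (studentT ν) z} := by
  simp_rw [studentQuantile, setIntegral_Iic_studentPDF hν]

lemma le_cdf_sInf (μ : Measure ℝ) [IsProbabilityMeasure μ] {u : ℝ} (hu : u < 1) :
    u ≤ cdf μ (sInf {z | u ≤ cdf μ z}) := by
  have hne : {z | u ≤ cdf μ z}.Nonempty :=
    ((tendsto_cdf_atTop μ).eventually_const_le hu).exists
  have hright := ((cdf μ).right_continuous (sInf {z | u ≤ cdf μ z})).mono_left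
    (nhdsWithin_mono _ Ioi_subset_Ici_self)
  refine ge_of_tendsto hright ?_
  filter_upwards [self_mem_nhdsWithin] with z hz
  obtain ⟨b, hb, hbz⟩ := exists_lt_of_csInf_lt hne hz
  exact hb.trans (monotone_cdf _ hbz.le)

lemma measure_Ioi_le_of_le_cdf {μ : Measure ℝ} [IsProbabilityMeasure μ] {u z : ℝ}
    (h : u ≤ cdf μ z) : μ (Ioi z) ≤ ENNReal.ofReal (1 - u) := by
  rw [← ofReal_measureReal, ← compl_Iic, probReal_compl_eq_one_sub measurableSet_Iic,
    ← cdf_eq_real]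
  gcongr

lemma studentT_Iio_neg_studentQuantile_le {ν : ℝ} (hν : 0 < ν) {γ : ℝ} (hγ : 0 < γ) :
    studentT ν (Iio (-studentQuantile ν (1 - γ))) ≤ ENNReal.ofReal γ := by
  have := isProbabilityMeasure_studentT hν
  have hcdf : 1 - γ ≤ cdf (studentT ν) (studentQuantile ν (1 - γ)) := by
    rw [studentQuantile_eq_sInf_cdf hν]
    exact le_cdf_sInf _ (by linarith)
  rw [← map_neg_studentT, Measure.map_apply measurable_neg measurableSet_Iio]
  simpa using measure_Ioi_le_of_le_cdf hcdf

/-! ### Sample statistics -/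

section Sample

variable {m : ℕ}

/-- The standardised sample mean as a function of the unknown mean `ρ`: the pivot of the posterior.
The factor is `√(m - 1)`, not `√m`, because `sampleDev` is normalised by `m`. -/
def tStatistic (y : Fin m → ℝ) (ρ : ℝ) : ℝ :=
  (sampleMean y - ρ) / sampleDev y * √((m : ℝ) - 1)

@[fun_prop]
lemma measurable_tStatistic (y : Fin m → ℝ) : Measurable (tStatistic y) := by
  unfold tStatistic
  fun_prop

lemma sampleDev_sq (y : Fin m → ℝ) :
    sampleDev y ^ 2 = (∑ i, y i ^ 2) / m - sampleMean y ^ 2 := by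
  have hcauchy : sampleMean y ^ 2 ≤ (∑ i, y i ^ 2) / m := by
    simpa [sampleMean] using sum_div_card_sq_le_sum_sq_div_card (s := Finset.univ) (f := y)
  exact Real.sq_sqrt (sub_nonneg.mpr hcauchy)

lemma one_lt_of_sampleDev_pos {y : Fin m → ℝ} (hS : 0 < sampleDev y) : (1 : ℝ) < m := by
  by_contra! hm
  have hm' : m ≤ 1 := by exact_mod_cast hm
  interval_cases m <;> simp [sampleDev, sampleMean] at hS

lemma sum_sub_sq_eq_sampleDev_sq_add (y : Fin m → ℝ) (ρ : ℝ) :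
    ∑ i, (y i - ρ) ^ 2 = m * (sampleDev y ^ 2 + (sampleMean y - ρ) ^ 2) := by
  rcases eq_or_ne m 0 with rfl | hm
  · simp
  have hexpand : ∑ i, (y i - ρ) ^ 2 = ∑ i, y i ^ 2 - 2 * ρ * ∑ i, y i + m * ρ ^ 2 := by
    simp only [sub_sq, Finset.sum_add_distrib, Finset.sum_sub_distrib, Finset.mul_sum,
      Finset.sum_const, Finset.card_univ, Fintype.card_fin, nsmul_eq_mul]
    congr! 3
    ring
  rw [hexpand, sampleDev_sq, sampleMean]
  field_simp
  ring

lemma sum_sub_sq_eq_mul_tStatistic {y : Fin m → ℝ} (hS : 0 < sampleDev y) (ρ : ℝ) :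
    ∑ i, (y i - ρ) ^ 2 = m * sampleDev y ^ 2 * (1 + tStatistic y ρ ^ 2 / (m - 1)) := by
  have hν : (0 : ℝ) < m - 1 := sub_pos.mpr (one_lt_of_sampleDev_pos hS)
  rw [sum_sub_sq_eq_sampleDev_sq_add, tStatistic, mul_pow, Real.sq_sqrt hν.le]
  field_simp

lemma map_tStatistic_volume {y : Fin m → ℝ} (hS : 0 < sampleDev y) :
    volume.map (tStatistic y) =
      ENNReal.ofReal (sampleDev y / √((m : ℝ) - 1)) • volume := by
  have hν : (0 : ℝ) < m - 1 := sub_pos.mpr (one_lt_of_sampleDev_pos hS)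
  have hk : 0 < √((m : ℝ) - 1) / sampleDev y := by positivity
  have hT : tStatistic y = fun ρ => (sampleMean y - ρ) * (√((m : ℝ) - 1) / sampleDev y) := by
    ext ρ
    rw [tStatistic, div_mul_eq_mul_div, mul_div_assoc]
  rw [hT, map_sub_left_mul_volume _ hk.ne', abs_of_pos (inv_pos.mpr hk), inv_div]

end Sample

/-! ### The posterior of the mean -/

section Posterior

variable {m : ℕ} {f : ℝ → ℝ → (Fin m → ℝ) → ℝ} {y : Fin m → ℝ}

lemma IsMaxEntropyModel.likelihood_eq (hf : IsMaxEntropyModel f) (y : Fin m → ℝ) (ρ τ : ℝ) :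
    f ρ (Real.exp τ) y = (√(2 * Real.pi))⁻¹ ^ m *
      Real.exp (-(m * τ) - (∑ i, (y i - ρ) ^ 2) / 2 * Real.exp (-2 * τ)) := by
  have hv : Real.toNNReal (Real.exp (2 * τ)) ≠ 0 := by simp [Real.exp_pos]
  have hsqrt : √(Real.exp (2 * τ)) = Real.exp τ := by
    rw [← Real.exp_half]
    ring_nf
  have h := congr_fun (hf.eq_gaussianProdPDF ρ hv) y
  rw [gaussianProdPDF_eq, Real.coe_toNNReal _ (Real.exp_pos _).le, Real.sqrt_mul (by positivity),
    hsqrt, Fintype.card_fin, mul_inv, mul_pow, ← Real.exp_neg, ← Real.exp_nat_mul, mul_assoc,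
    ← Real.exp_add] at h
  rw [h, neg_mul 2 τ, Real.exp_neg]
  congr 2
  ring

lemma IsMaxEntropyModel.measurable_likelihood (hf : IsMaxEntropyModel f) (y : Fin m → ℝ) :
    Measurable fun θ : ℝ × ℝ => ENNReal.ofReal (f θ.1 (Real.exp θ.2) y) := by
  simp_rw [hf.likelihood_eq]
  fun_prop

/-- Given `ρ`, the precision `u = exp (-2 τ)` has a Gamma law, whose normalising constant is the
density of `ρ`; the factor `|-2| * exp (-2 * τ)` is `|du / dτ|`. -/
lemma IsMaxEntropyModel.exists_likelihood_eq_mul (hf : IsMaxEntropyModel f)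
    (hS : 0 < sampleDev y) :
    ∃ K : ℝ, 0 < K ∧ ∀ ρ τ, f ρ (Real.exp τ) y = K * studentPDF (m - 1) (tStatistic y ρ) *
      (|-2| * Real.exp (-2 * τ) *
        gammaPDFReal (m / 2) ((∑ i, (y i - ρ) ^ 2) / 2) (Real.exp (-2 * τ))) := by
  have hm : (1 : ℝ) < m := one_lt_of_sampleDev_pos hS
  have hν : (0 : ℝ) < m - 1 := sub_pos.mpr hm
  refine ⟨(√(2 * Real.pi))⁻¹ ^ m * (√((m - 1) * Real.pi) * Real.Gamma ((m - 1) / 2)) /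
    (2 * (m * sampleDev y ^ 2 / 2) ^ (m / 2 : ℝ)), by positivity, fun ρ τ => ?_⟩
  have hbase : 0 < 1 + tStatistic y ρ ^ 2 / (m - 1) := by positivity
  have hrate : (∑ i, (y i - ρ) ^ 2) / 2 =
      m * sampleDev y ^ 2 / 2 * (1 + tStatistic y ρ ^ 2 / (m - 1)) := by
    rw [sum_sub_sq_eq_mul_tStatistic hS]
    ring
  have hexp : Real.exp (-(m * τ) - (∑ i, (y i - ρ) ^ 2) / 2 * Real.exp (-2 * τ)) =
      Real.exp (-2 * τ) * Real.exp (-2 * τ) ^ (m / 2 - 1 : ℝ) *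
        Real.exp (-((∑ i, (y i - ρ) ^ 2) / 2 * Real.exp (-2 * τ))) := by
    rw [← Real.exp_mul, ← Real.exp_add, ← Real.exp_add]
    congr 1
    ring
  rw [hf.likelihood_eq, hexp, gammaPDFReal, if_pos (Real.exp_pos _).le, studentPDF,
    sub_add_cancel, Real.rpow_neg hbase.le]
  nth_rewrite 2 [hrate]
  rw [Real.mul_rpow (by positivity) hbase.le, abs_neg, abs_two]
  field_simp

lemma IsMaxEntropyModel.exists_lintegral_likelihood_eq (hf : IsMaxEntropyModel f)
    (hS : 0 < sampleDev y) :
    ∃ K : ℝ, 0 < K ∧ ∀ ρ, ∫⁻ τ, ENNReal.ofReal (f ρ (Real.exp τ) y) =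
      ENNReal.ofReal K * ENNReal.ofReal (studentPDF (m - 1) (tStatistic y ρ)) := by
  have hm : (1 : ℝ) < m := one_lt_of_sampleDev_pos hS
  obtain ⟨K, hK, hlik⟩ := hf.exists_likelihood_eq_mul hS
  refine ⟨K, hK, fun ρ => ?_⟩
  have hpdf := studentPDF_nonneg (sub_pos.mpr hm) (tStatistic y ρ)
  have hrate : 0 < (∑ i, (y i - ρ) ^ 2) / 2 := by
    rw [sum_sub_sq_eq_sampleDev_sq_add]
    positivity
  simp_rw [hlik ρ, ENNReal.ofReal_mul (mul_nonneg hK.le hpdf),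
    ENNReal.ofReal_mul (by positivity : 0 ≤ |(-2 : ℝ)| * Real.exp _)]
  rw [lintegral_const_mul' _ _ ENNReal.ofReal_ne_top]
  simp_rw [← gammaPDF.eq_def]
  rw [lintegral_comp_exp_mul (by norm_num) (gammaPDF (m / 2) _),
    setLIntegral_Ioi_gammaPDF (by positivity) hrate, mul_one, ENNReal.ofReal_mul hK.le]

lemma IsMaxEntropyModel.exists_map_jointWeight_eq (hf : IsMaxEntropyModel f)
    (hS : 0 < sampleDev y) :
    ∃ c : ℝ, 0 < c ∧ (jointWeight f y).map (fun θ => tStatistic y θ.1) =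
      ENNReal.ofReal c • studentT (m - 1) := by
  have hν : (0 : ℝ) < m - 1 := sub_pos.mpr (one_lt_of_sampleDev_pos hS)
  obtain ⟨K, hK, hlik⟩ := hf.exists_lintegral_likelihood_eq hS
  have hpdf : Measurable fun z => ENNReal.ofReal (studentPDF (m - 1) z) :=
    (measurable_studentPDF _).ennreal_ofReal
  refine ⟨K * (sampleDev y / √((m : ℝ) - 1)), by positivity, ?_⟩
  calc (jointWeight f y).map (fun θ => tStatistic y θ.1)
      = ((jointWeight f y).map Prod.fst).map (tStatistic y) :=
        (Measure.map_map (measurable_tStatistic y) measurable_fst).symm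
    _ = (volume.withDensity fun ρ => ∫⁻ τ, ENNReal.ofReal (f ρ (Real.exp τ) y)).map
          (tStatistic y) := by
        rw [jointWeight, flatPrior, Measure.volume_eq_prod,
          map_fst_withDensity_prod _ _ (hf.measurable_likelihood y)]
    _ = ENNReal.ofReal K • (volume.withDensity fun ρ =>
          ENNReal.ofReal (studentPDF (m - 1) (tStatistic y ρ))).map (tStatistic y) := by
        simp_rw [hlik]
        rw [← Measure.map_smul]
        exact congrArg _ (withDensity_smul _ (hpdf.comp (measurable_tStatistic y)))
    _ = ENNReal.ofReal K • (volume.map (tStatistic y)).withDensity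
          fun z => ENNReal.ofReal (studentPDF (m - 1) z) := by
        rw [map_withDensity_comp (measurable_tStatistic y) hpdf]
    _ = ENNReal.ofReal (K * (sampleDev y / √((m : ℝ) - 1))) • studentT (m - 1) := by
        rw [map_tStatistic_volume hS, withDensity_smul_measure, smul_smul,
          ← ENNReal.ofReal_mul hK.le, studentT]

lemma IsMaxEntropyModel.isProbabilityMeasure_posterior (hf : IsMaxEntropyModel f)
    (hS : 0 < sampleDev y) : IsProbabilityMeasure (posterior f y) := by
  have := isProbabilityMeasure_studentT (sub_pos.mpr (one_lt_of_sampleDev_pos hS))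
  obtain ⟨c, hc, hmap⟩ := hf.exists_map_jointWeight_eq hS
  have hmass := measure_univ_eq_of_map_eq_smul (by fun_prop) hmap
  refine ⟨?_⟩
  rw [posterior, Measure.smul_apply, smul_eq_mul, hmass,
    ENNReal.inv_mul_cancel (by simpa using hc) ENNReal.ofReal_ne_top]

lemma IsMaxEntropyModel.map_tStatistic_posterior (hf : IsMaxEntropyModel f)
    (hS : 0 < sampleDev y) :
    (posterior f y).map (fun θ => tStatistic y θ.1) = studentT (m - 1) := by
  have := isProbabilityMeasure_studentT (sub_pos.mpr (one_lt_of_sampleDev_pos hS))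
  obtain ⟨c, hc, hmap⟩ := hf.exists_map_jointWeight_eq hS
  have hmass := measure_univ_eq_of_map_eq_smul (by fun_prop) hmap
  rw [posterior, Measure.map_smul, hmap, hmass, smul_smul,
    ENNReal.inv_mul_cancel (by simpa using hc) ENNReal.ofReal_ne_top, one_smul]

end Posterior

/-! ### Coverage of the estimator -/

lemma extLog_mono : Monotone extLog := fun _ _ h =>
  ENNReal.log_monotone (ENNReal.ofReal_le_ofReal h)

lemma tStatistic_lt_of_costEstimator_lt {m : ℕ} {γ ρ : ℝ} {y : Fin m → ℝ}
    (hS : 0 < sampleDev y) (h : costEstimator γ y < extLog ρ) :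
    tStatistic y ρ < -studentQuantile (m - 1) (1 - γ) := by
  have hν : (0 : ℝ) < m - 1 := sub_pos.mpr (one_lt_of_sampleDev_pos hS)
  have hlt := extLog_mono.reflect_lt h
  set q := studentQuantile (m - 1) (1 - γ)
  calc tStatistic y ρ
      < -(q / √((m : ℝ) - 1) * sampleDev y) / sampleDev y * √((m : ℝ) - 1) := by
        rw [tStatistic]
        gcongr
        linarith
    _ = -q := by field_simp

lemma IsMaxEntropyModel.posterior_costEstimator_lt_le {m : ℕ} {f : ℝ → ℝ → (Fin m → ℝ) → ℝ}
    (hf : IsMaxEntropyModel f) {y : Fin m → ℝ} (hS : 0 < sampleDev y) {γ : ℝ} (hγ : 0 < γ) :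
    posterior f y {θ | costEstimator γ y < extLog θ.1} ≤ ENNReal.ofReal γ := by
  calc posterior f y {θ | costEstimator γ y < extLog θ.1}
      ≤ posterior f y ((fun θ => tStatistic y θ.1) ⁻¹'
          Iio (-studentQuantile (m - 1) (1 - γ))) :=
        measure_mono fun _ hθ => tStatistic_lt_of_costEstimator_lt hS hθ
    _ = studentT (m - 1) (Iio (-studentQuantile (m - 1) (1 - γ))) := by
        rw [← hf.map_tStatistic_posterior hS, Measure.map_apply (by fun_prop) measurableSet_Iio]
    _ ≤ ENNReal.ofReal γ :=
        studentT_Iio_neg_studentQuantile_le (sub_pos.mpr (one_lt_of_sampleDev_pos hS)) hγ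

lemma privacyCost_le_log_expectedExpDiv {X W : Type*} [MeasurableSpace X] [MeasurableSpace W]
    (p : Multiset X → Measure W) {lam : ℝ} (hlam : 0 ≤ lam) (D : Multiset X) (μ : Measure X) :
    privacyCost p lam D μ ≤ ENNReal.log (expectedExpDiv p lam D μ) := by
  have hlog : Monotone fun h : X → EReal =>
      ENNReal.log (∫⁻ x, EReal.exp ((lam : EReal) * h x) ∂μ) := fun g h hgh =>
    ENNReal.log_monotone <| lintegral_mono fun x => EReal.exp_monotone <|
      mul_le_mul_of_nonneg_left (hgh x) (EReal.coe_nonneg.mpr hlam)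
  exact max_le (hlog fun _ => le_max_left _ _) (hlog fun _ => le_max_right _ _)

end BayesDP

end

theorem theorem3_general {X W : Type*} [MeasurableSpace X] [MeasurableSpace W]
    (p : Multiset X → Measure W) {lam : ℝ} (hlam : 0 < lam) {γ : ℝ} (hγ : 0 < γ)
    {m : ℕ} {y : Fin m → ℝ} (hS : 0 < BayesDP.sampleDev y)
    {f : ℝ → ℝ → (Fin m → ℝ) → ℝ} (hf : BayesDP.IsMaxEntropyModel f) :
    IsProbabilityMeasure (BayesDP.posterior f y) ∧
    (BayesDP.posterior f y).map
        (fun θ => (BayesDP.sampleMean y - θ.1) / BayesDP.sampleDev y * Real.sqrt ((m : ℝ) - 1))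
      = BayesDP.studentT ((m : ℝ) - 1) ∧
    BayesDP.posterior f y {θ | BayesDP.costEstimator γ y < BayesDP.extLog θ.1}
      ≤ ENNReal.ofReal γ ∧
    ∀ D : Multiset X,
      BayesDP.posterior f y {θ | ∃ μ : Measure X, IsProbabilityMeasure μ ∧
          BayesDP.expectedExpDiv p lam D μ = ENNReal.ofReal θ.1 ∧
          BayesDP.costEstimator γ y < BayesDP.privacyCost p lam D μ}
        ≤ ENNReal.ofReal γ := by
  have hcost := hf.posterior_costEstimator_lt_le hS hγ
  refine ⟨hf.isProbabilityMeasure_posterior hS, hf.map_tStatistic_posterior hS, hcost,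
    fun D => (measure_mono ?_).trans hcost⟩
  rintro θ ⟨μ, -, hμ, hlt⟩
  rw [mem_ofPred_eq, BayesDP.extLog, ← hμ]
  exact hlt.trans_le (BayesDP.privacyCost_le_log_expectedExpDiv p hlam.le D μ)

theorem theorem3 {X W : Type*} [MeasurableSpace X] [DecidableEq X] [MeasurableSpace W]
    -- `p t w B` is the law of the outcome of iteration `t` given the previous outcome `w`
    (p : ℕ → W → Multiset X → Measure W) (hp : ∀ t w B, IsProbabilityMeasure (p t w B))
    (t : ℕ) (w : W) (lam : ℝ) (hlam : 0 < lam) (γ : ℝ) (hγ0 : 0 < γ) (hγ1 : γ < 1)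
    -- the batch and the sample points, with finite divergences
    (B : Multiset X) (m : ℕ) (hm : 2 ≤ m) (x : Fin m → X) (hx : ∀ i, x i ∈ B)
    (hfin : ∀ i, BayesDP.maxRenyi lam (p t w B) (p t w (B.erase (x i))) ≠ ⊤)
    (y : Fin m → ℝ) (hy : y = BayesDP.sampleValue (p t w) lam B x)
    (hS : 0 < BayesDP.sampleDev y)
    (f : ℝ → ℝ → (Fin m → ℝ) → ℝ) (hf : BayesDP.IsMaxEntropyModel f) :
    -- the posterior is proper
    IsProbabilityMeasure (BayesDP.posterior f y) ∧
    -- the standardised mean has Student's t-distribution under the posterior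
    (BayesDP.posterior f y).map
        (fun θ => (BayesDP.sampleMean y - θ.1) / BayesDP.sampleDev y * Real.sqrt ((m : ℝ) - 1))
      = BayesDP.studentT ((m : ℝ) - 1) ∧
    -- the estimator is below the logarithm of the unknown mean with probability at most `γ`
    BayesDP.posterior f y {θ | BayesDP.costEstimator γ y < BayesDP.extLog θ.1}
      ≤ ENNReal.ofReal γ ∧
    -- hence so is the event that it is below the privacy cost of some data distribution `μ` for
    -- which the expectation of the sample values is the unknown mean
    ∀ D : Multiset X,
      BayesDP.posterior f y {θ | ∃ μ : Measure X, IsProbabilityMeasure μ ∧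
          BayesDP.expectedExpDiv (p t w) lam D μ = ENNReal.ofReal θ.1 ∧
          BayesDP.costEstimator γ y < BayesDP.privacyCost (p t w) lam D μ}
        ≤ ENNReal.ofReal γ :=
  theorem3_general (p t w) hlam hγ0 hS hf
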